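/- Let $L$ be a locale (frame) which is compact (its top element $1$ is compact) and regular (every $l\in L$ is a join $l=\bigvee_i l_i$ of elements for which there are $t_i\in L$ with $t_i\wedge l_i=0$ and $t_i\vee l=1$). Let $\mathbf{Sh}(L)$ be the topos of sheaves on $L$ for the topology $J$ in which $(x_i)_i$ covers $x$ iff $\bigvee_i x_i=x$, and let $\Omega$ be its subobject classifier; $\Omega(l)$ is the frame of $J$-closed sieves on $l$. For an internal distributive lattice $A$ in $\mathbf{Sh}(L)$, let $\mathcal G(A)$ be the category whose objects are the pairs $(l,x)$ with $l\in L$, $x\in A(l)$, with a (unique) morphism $(m,y)\to(l,x)$ iff $m\le l$ and $y\le x|_m$. Let $K$ be the Grothendieck topology on $\mathcal G(A)$ generated by the finite families $((l,x_i)\to(l,x))_i$ with $\bigvee_i x_i=x$ and the families $((l_i,x|_{l_i})\to(l,x))_i$ with $\bigvee_i l_i=l$. The internal ideal completion $\mathrm{Idl}(A)$ is the sheaf of frames on $L$ whose value at $l$ is the frame of $K$-closed sieves on $(l,1)$, with restriction given by pullback of sieves. The canonical morphism $A\to\mathrm{Idl}(A)$ sends $x\in A(l)$ to the $K$-closure of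 the sieve generated by $(l,x)\to(l,1)$. Then in $\mathbf{Sh}(L)$ one has $\mathrm{Idl}(\Omega)=\Omega$ if and only if $\Omega=1\sqcup 1$, where $\Omega=1\sqcup1$ means that the canonical morphism $(\top,\bot):1\sqcup 1\to\Omega$ is an isomorphism, and where $\mathrm{Idl}(\Omega)=\Omega$ may be read in either of the following two ways: $\mathrm{Idl}(\Omega)$ and $\Omega$ are isomorphic as sheaves of frames (internal locales), or the canonical morphism $\Omega\to\mathrm{Idl}(\Omega)$ is an isomorphism. Moreover, $\Omega=1\sqcup1$ if and only if $\mathbf{Sh}(L)$ is Boolean, i.e. $\Omega$ is an internal Boolean algebra: every $\Omega(l)$ is a Boolean algebra. -/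

import Mathlib

open CategoryTheory CategoryTheory.Limits Opposite

universe w v u

namespace LocalicTopos

/-! ### Closed sieves -/

section ClosedSieves

variable {C : Type u} [Category.{v} C] (J : GrothendieckTopology C)

/-- The `J`-closed sieves on `c`, ordered by inclusion. -/
abbrev ClosedSieve (c : C) : Type (max u v) :=
  {S : Sieve c // J.IsClosed S}

/-- Closed sieves form a complete lattice: meets are intersections, and joins are closures of
unions. -/
noncomputable instance ClosedSieve.completeLattice (c : C) : CompleteLattice (ClosedSieve J c) :=
  GaloisInsertion.liftCompleteLattice (α := Sieve c) (β := ClosedSieve J c)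
    (l := fun S => ⟨J.close S, J.close_isClosed S⟩) (u := Subtype.val)
    { choice := fun S hS => ⟨S, by
        have h : J.close S = S := le_antisymm hS (J.le_close S)
        exact (J.isClosed_iff_close_eq_self S).2 h⟩
      gc := fun S T => ⟨fun h => (J.le_close S).trans h, fun h => J.le_close_of_isClosed h T.2⟩
      le_l_u := fun S => J.le_close S.1
      choice_eq := fun S hS => Subtype.ext (le_antisymm (J.le_close S) hS) }

variable {J}

theorem ClosedSieve.sSup_val {c : C} (s : Set (ClosedSieve J c)) :
    (sSup s).1 = J.close (sSup (Subtype.val '' s)) := rfl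

theorem ClosedSieve.inf_val {c : C} (S T : ClosedSieve J c) : (S ⊓ T).1 = S.1 ⊓ T.1 := rfl

theorem ClosedSieve.top_val {c : C} : (⊤ : ClosedSieve J c).1 = ⊤ := rfl

theorem ClosedSieve.mem_sSup {c d : C} (s : Set (ClosedSieve J c)) (f : d ⟶ c) :
    (sSup s).1 f ↔ J.Covers (sSup (Subtype.val '' s)) f := Iff.rfl

noncomputable instance ClosedSieve.frame (c : C) : Order.Frame (ClosedSieve J c) :=
  Order.Frame.ofMinimalAxioms
    { ClosedSieve.completeLattice J c with
      inf_sSup_le_iSup_inf := by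
        intro a s d f hf
        obtain ⟨ha, hs⟩ := hf
        refine (⨆ b ∈ s, a ⊓ b).2 f ?_
        refine J.superset_covering ?_ hs
        intro e g hg
        obtain ⟨_, ⟨b, hb, rfl⟩, hbg⟩ := hg
        have h : a ⊓ b ≤ ⨆ b ∈ s, a ⊓ b := le_iSup₂_of_le b hb le_rfl
        exact h _ ⟨a.1.downward_closed ha g, hbg⟩ }

/-- Restriction of closed sieves along `f : d ⟶ c`, that is pullback of sieves. -/
noncomputable def ClosedSieve.pullback {c d : C} (f : d ⟶ c) :
    FrameHom (ClosedSieve J c) (ClosedSieve J d) where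
  toFun S := ⟨S.1.pullback f, J.isClosed_pullback f S.1 S.2⟩
  map_inf' _ _ := rfl
  map_top' := rfl
  map_sSup' s := by
    apply Subtype.ext
    apply Sieve.ext
    intro e g
    change J.Covers _ (g ≫ f) ↔ J.Covers _ g
    rw [J.covers_iff, J.covers_iff, Sieve.pullback_comp]
    have h : Sieve.pullback f (sSup (Subtype.val '' s)) =
        sSup (Subtype.val '' ((fun S : ClosedSieve J c =>
          (⟨S.1.pullback f, J.isClosed_pullback f S.1 S.2⟩ : ClosedSieve J d)) '' s)) := by
      apply Sieve.ext
      intro e g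
      constructor
      · rintro ⟨_, ⟨b, hb, rfl⟩, hbg⟩
        exact ⟨_, ⟨_, ⟨b, hb, rfl⟩, rfl⟩, hbg⟩
      · rintro ⟨_, ⟨_, ⟨b, hb, rfl⟩, rfl⟩, hbg⟩
        exact ⟨_, ⟨b, hb, rfl⟩, hbg⟩
    rw [h]

variable (J)

/-- The functor of closed sieves, with its pointwise structure of frame. -/
noncomputable def closedSieveFrm : Cᵒᵖ ⥤ Frm.{max u v} where
  obj c := Frm.of (ClosedSieve J c.unop)
  map f := Frm.ofHom (ClosedSieve.pullback f.unop)
  map_id c := by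
    apply Frm.ext
    intro S
    exact Subtype.ext (α := Sieve c.unop) (p := J.IsClosed) Sieve.pullback_id
  map_comp {c d e} f g := by
    apply Frm.ext
    intro S
    exact Subtype.ext (α := Sieve e.unop) (p := J.IsClosed) (Sieve.pullback_comp _)

theorem closedSieveFrm_isSheaf : Presieve.IsSheaf J (closedSieveFrm J ⋙ forget Frm) :=
  classifier_isSheaf J

end ClosedSieves

/-! ### Internal distributive lattices and internal frames -/

section Internal

variable {C : Type u} [Category.{v} C] (J : GrothendieckTopology C)

/-- An internal (bounded) distributive lattice in `Sh(C, J)`: a sheaf of bounded distributive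
lattices. -/
structure DistLatSheaf where
  /-- the underlying functor -/
  functor : Cᵒᵖ ⥤ BddDistLat.{w}
  isSheaf : Presieve.IsSheaf J (functor ⋙ forget BddDistLat)

/-- A sheaf of frames whose restriction maps are frame homomorphisms. -/
structure FrameSheaf where
  /-- the underlying functor -/
  functor : Cᵒᵖ ⥤ Frm.{w}
  isSheaf : Presieve.IsSheaf J (functor ⋙ forget Frm)

/-- The functor forgetting infinite joins. -/
def frmToBddDistLat : Frm.{w} ⥤ BddDistLat.{w} where
  obj X := BddDistLat.of X
  map f := BddDistLat.ofHom
    { toFun := f.hom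
      map_sup' := map_sup f.hom
      map_inf' := map_inf f.hom
      map_top' := map_top f.hom
      map_bot' := map_bot f.hom }

variable {J}

/-- The underlying sheaf of sets of an internal distributive lattice. -/
def DistLatSheaf.sheaf (A : DistLatSheaf.{w} J) : Sheaf J (Type w) :=
  ⟨A.functor ⋙ forget BddDistLat, (isSheaf_iff_isSheaf_of_type _ _).2 A.isSheaf⟩

/-- A sheaf of frames is in particular an internal distributive lattice. -/
def FrameSheaf.toDistLatSheaf (F : FrameSheaf.{w} J) : DistLatSheaf.{w} J where
  functor := F.functor ⋙ frmToBddDistLat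
  isSheaf := F.isSheaf

/-- The underlying sheaf of sets of a sheaf of frames. -/
abbrev FrameSheaf.sheaf (F : FrameSheaf.{w} J) : Sheaf J (Type w) :=
  F.toDistLatSheaf.sheaf

/-- Two sheaves of frames are isomorphic when there are frame isomorphisms between their values
which commute with the restriction maps. -/
def FrameSheaf.IsIsomorphic (F G : FrameSheaf.{w} J) : Prop :=
  Nonempty (F.functor ≅ G.functor)

/-- The global section `⊤ : 1 ⟶ A`. -/
noncomputable def DistLatSheaf.topMap (A : DistLatSheaf.{w} J) :
    ⊤_ (Sheaf J (Type w)) ⟶ A.sheaf where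
  hom :=
    { app := fun c => ↾fun _ => (⊤ : A.functor.obj c)
      naturality := by
        intro c d f
        ext x
        exact (map_top (A.functor.map f).hom).symm }

/-- The global section `⊥ : 1 ⟶ A`. -/
noncomputable def DistLatSheaf.botMap (A : DistLatSheaf.{w} J) :
    ⊤_ (Sheaf J (Type w)) ⟶ A.sheaf where
  hom :=
    { app := fun c => ↾fun _ => (⊥ : A.functor.obj c)
      naturality := by
        intro c d f
        ext x
        exact (map_bot (A.functor.map f).hom).symm }

variable (J)

/-- The subobject classifier `Ω` of `Sh(C, J)`, with its pointwise structure of frame: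
`Ω(c)` is the frame of `J`-closed sieves on `c`. -/
noncomputable def omega : FrameSheaf.{max u v} J where
  functor := closedSieveFrm J
  isSheaf := closedSieveFrm_isSheaf J

/-- The underlying sheaf of `omega J` is the subobject classifier. -/
theorem omega_sheaf : (omega J).sheaf = (Sheaf.classifier J).Ω := rfl

instance : HasWeakSheafify J (Type (max u v)) :=
  have : HasSheafify J (Type (max u v)) := instHasSheafifyType J
  inferInstance

instance : HasBinaryCoproducts (Sheaf J (Type (max u v))) := Sheaf.instHasColimitsOfShape

/-- The canonical morphism `(⊤, ⊥) : 1 ⊔ 1 ⟶ Ω` of `Sh(C, J)`. -/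
noncomputable def twoToOmega :
    (⊤_ (Sheaf J (Type (max u v)))) ⨿ (⊤_ (Sheaf J (Type (max u v)))) ⟶ (omega J).sheaf :=
  coprod.desc (omega J).toDistLatSheaf.topMap (omega J).toDistLatSheaf.botMap

/-- `Sh(C, J)` is Boolean when `Ω` is an internal Boolean algebra, that is, when every `J`-closed
sieve has a complement in the lattice of `J`-closed sieves on the same object. -/
def IsBooleanSite : Prop :=
  ∀ c : C, ComplementedLattice ((omega J).functor.obj (op c))

end Internal

/-! ### The Grothendieck construction and the coherent topology -/

section Completion

variable {C : Type u} [Category.{v} C]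

/-- Objects of the Grothendieck construction `𝒢(A)`: pairs `(c, x)` with `x ∈ A(c)`. -/
structure Total (A : Cᵒᵖ ⥤ BddDistLat.{w}) where
  /-- the object of the base -/
  base : C
  /-- the element of the fibre -/
  fib : A.obj (op base)

namespace Total

variable {A : Cᵒᵖ ⥤ BddDistLat.{w}}

/-- A morphism `(d, y) ⟶ (c, x)` is a morphism `f : d ⟶ c` such that `y ≤ A(f)(x)`. -/
@[ext]
structure Hom (Y X : Total A) where
  /-- the morphism of the base -/
  base : Y.base ⟶ X.base
  le : Y.fib ≤ A.map base.op X.fib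

instance : Category.{v} (Total A) where
  Hom Y X := Hom Y X
  id X := ⟨𝟙 _, by simp⟩
  comp {Z Y X} g f := ⟨g.base ≫ f.base, by
    refine g.le.trans ?_
    rw [op_comp, A.map_comp]
    exact OrderHomClass.mono (A.map g.base.op).hom f.le⟩
  id_comp f := Hom.ext (Category.id_comp f.base)
  comp_id f := Hom.ext (Category.comp_id f.base)
  assoc f g h := Hom.ext (Category.assoc f.base g.base h.base)

/-- The vertical morphism `(c, y) ⟶ (c, x)` for `y ≤ x`. -/
def vertical {c : C} {y x : A.obj (op c)} (h : y ≤ x) : (⟨c, y⟩ : Total A) ⟶ ⟨c, x⟩ :=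
  (⟨𝟙 c, by simpa using h⟩ : Hom (⟨c, y⟩ : Total A) ⟨c, x⟩)

/-- The cartesian morphism `(d, A(f)(x)) ⟶ (c, x)` over `f : d ⟶ c`. -/
def lift {c d : C} (f : d ⟶ c) (x : A.obj (op c)) :
    (⟨d, A.map f.op x⟩ : Total A) ⟶ ⟨c, x⟩ :=
  (⟨f, le_rfl⟩ : Hom (⟨d, A.map f.op x⟩ : Total A) ⟨c, x⟩)

variable (A)

/-- The functor `c ↦ (c, ⊤)`, right adjoint to the projection `(c, x) ↦ c`. -/
def top : C ⥤ Total A where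
  obj c := ⟨c, ⊤⟩
  map {d c} f := (⟨f, (map_top (A.map f.op).hom).ge⟩ :
    Hom (⟨d, ⊤⟩ : Total A) ⟨c, ⊤⟩)

/-- The families generating the coherent topology on `𝒢(A)`. -/
inductive CoherentCovering (J : GrothendieckTopology C) : ∀ X : Total A, Presieve X → Prop
  /-- The finite families `(c, xᵢ) ⟶ (c, x)` over the identity of `c` with `⋁ xᵢ = x`. -/
  | join (c : C) (s : Finset (A.obj (op c))) :
      CoherentCovering J ⟨c, s.sup id⟩
        (Presieve.ofArrows (fun y : s => (⟨c, y.1⟩ : Total A))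
          (fun y => vertical (Finset.le_sup (f := id) y.2)))
  /-- The families `(cᵢ, A(fᵢ)(x)) ⟶ (c, x)` for a covering family `fᵢ : cᵢ ⟶ c`. -/
  | base (c : C) (x : A.obj (op c)) (S : J.Cover c) :
      CoherentCovering J ⟨c, x⟩
        (Presieve.ofArrows (fun i : S.Arrow => (⟨i.Y, A.map i.f.op x⟩ : Total A))
          (fun i => lift i.f x))

/-- The coherent topology `K` on `𝒢(A)`: the Grothendieck topology generated by
`CoherentCovering`. -/
def coherentTopology (J : GrothendieckTopology C) : GrothendieckTopology (Total A) :=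
  Precoverage.toGrothendieck ⟨fun X => {R | CoherentCovering A J X R}⟩

end Total

variable {J : GrothendieckTopology C}

open Total

instance (A : Cᵒᵖ ⥤ BddDistLat.{w}) :
    (Total.top A).IsContinuous J (coherentTopology A J) := by
  apply Functor.isContinuous_of_coverPreserving
  · constructor
    intro F Z T x hx Y₁ Y₂ X f₁ f₂ g₁ g₂ hg₁ hg₂ h
    let p : X ⟶ (Total.top A).obj X.base :=
      (⟨𝟙 _, le_top.trans (map_top (A.map (𝟙 X.base).op).hom).ge⟩ : Hom X ⟨X.base, ⊤⟩)
    have e₁ : f₁ = p ≫ (Total.top A).map f₁.base := Hom.ext (Category.id_comp _).symm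
    have e₂ : f₂ = p ≫ (Total.top A).map f₂.base := Hom.ext (Category.id_comp _).symm
    have hb : f₁.base ≫ g₁ = f₂.base ≫ g₂ := congrArg Hom.base h
    have := hx f₁.base f₂.base hg₁ hg₂ hb
    have key : ∀ {Y : C} (k : X.base ⟶ Y) (a : F.obj.obj (op ((Total.top A).obj Y))),
        F.obj.map (p ≫ (Total.top A).map k).op a =
          F.obj.map p.op (F.obj.map ((Total.top A).map k).op a) := by
      intro Y k a
      simp
    rw [e₁, e₂]
    exact (key _ _).trans ((congrArg (F.obj.map p.op) this).trans (key _ _).symm)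
  · constructor
    intro c S hS
    have h := Precoverage.generate_mem_toGrothendieck
      (J := ⟨fun X => {R | CoherentCovering A J X R}⟩) (CoherentCovering.base c ⊤ (⟨S, hS⟩ : J.Cover c))
    refine GrothendieckTopology.superset_covering _ ?_ h
    refine (Sieve.generate_le_iff _ _).2 ?_
    rintro _ _ ⟨i⟩
    refine ⟨i.Y, i.f, ?_, i.hf, ?_⟩
    · exact (⟨𝟙 _, le_top.trans (map_top (A.map (𝟙 i.Y).op).hom).ge⟩ :
        Hom (⟨i.Y, A.map i.f.op ⊤⟩ : Total A) ⟨i.Y, ⊤⟩)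
    · exact Hom.ext (Category.id_comp _).symm

/-- The internal ideal completion of an internal distributive lattice `A`: the value of `Idl(A)`
at `c` is the frame of `K`-closed sieves on `(c, ⊤)`, where `K` is the coherent topology on
`𝒢(A)`, and restriction along `f : d ⟶ c` is pullback along `f : (d, ⊤) ⟶ (c, ⊤)`. -/
noncomputable def idl (A : DistLatSheaf.{w} J) : FrameSheaf.{max u v w} J where
  functor := (Total.top A.functor).op ⋙ closedSieveFrm (coherentTopology A.functor J)
  isSheaf := Functor.op_comp_isSheaf_of_isSheaf_type (F := Total.top A.functor) J
    (closedSieveFrm_isSheaf (coherentTopology A.functor J))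

/-- The sieve on `(c, ⊤)` generated by the vertical morphism `(c, x) ⟶ (c, ⊤)`. -/
def principalSieve (A : Cᵒᵖ ⥤ BddDistLat.{w}) {c : C} (x : A.obj (op c)) :
    Sieve (⟨c, ⊤⟩ : Total A) :=
  Sieve.generate (Presieve.singleton (vertical (le_top : x ≤ ⊤)))

theorem principalSieve_apply (A : Cᵒᵖ ⥤ BddDistLat.{w}) {c : C} (x : A.obj (op c))
    {Y : Total A} (g : Hom Y (⟨c, ⊤⟩ : Total A)) :
    (principalSieve A x).arrows (Y := Y) g ↔ Y.fib ≤ A.map g.base.op x := by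
  constructor
  · rintro ⟨Z, h, k, hk, hg⟩
    obtain ⟨⟩ := hk
    have e : g.base = Hom.base h :=
      (congrArg Hom.base hg).symm.trans (Category.comp_id (Hom.base h))
    rw [e]
    exact Hom.le h
  · intro h
    exact ⟨⟨c, x⟩, (⟨g.base, h⟩ : Hom Y ⟨c, x⟩), _, ⟨⟩, Hom.ext (Category.comp_id _)⟩

theorem principalSieve_pullback (A : Cᵒᵖ ⥤ BddDistLat.{w}) {c d : C} (f : d ⟶ c)
    (x : A.obj (op c)) :
    (principalSieve A x).pullback ((Total.top A).map f) = principalSieve A (A.map f.op x) := by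
  apply Sieve.ext
  intro Y g
  have e : ∀ k : Y.base ⟶ d, A.map (k ≫ f).op x = A.map k.op (A.map f.op x) := by
    intro k
    rw [op_comp, A.map_comp]
    rfl
  exact (principalSieve_apply A x _).trans
    ((iff_of_eq (congrArg (Y.fib ≤ ·) (e (Hom.base g)))).trans (principalSieve_apply A (A.map f.op x) g).symm)

/-- The canonical morphism `A ⟶ Idl(A)` of sheaves, sending `x ∈ A(c)` to the `K`-closure of the
sieve generated by `(c, x) ⟶ (c, ⊤)`. -/
noncomputable def toIdl (A : DistLatSheaf.{max u v} J) : A.sheaf ⟶ (idl A).sheaf where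
  hom :=
    { app := fun c => ↾fun x : A.functor.obj (op c.unop) =>
        (⟨(coherentTopology A.functor J).close (principalSieve A.functor x),
          (coherentTopology A.functor J).close_isClosed _⟩ :
          ClosedSieve (coherentTopology A.functor J) ((Total.top A.functor).obj c.unop))
      naturality := by
        intro c d f
        ext x
        apply Subtype.ext
        exact (congrArg (coherentTopology A.functor J).close
          (principalSieve_pullback A.functor f.unop x).symm).trans
          ((coherentTopology A.functor J).pullback_close ((Total.top A.functor).map f.unop)
            (principalSieve A.functor x)) }

end Completion

/-! ### Locales -/

section Locale

variable (L : Type u) [Order.Frame L]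

/-- The canonical topology on a frame: a sieve on `x` covers when the join of the domains of its
members is `x`. -/
def localeTopology : GrothendieckTopology L where
  sieves x := {S | sSup {y | ∃ f : y ⟶ x, S f} = x}
  top_mem' x := le_antisymm (sSup_le fun _ ⟨f, _⟩ => f.le) (le_sSup ⟨𝟙 x, trivial⟩)
  pullback_stable' x y S f hS := by
    refine le_antisymm (sSup_le fun _ ⟨f, _⟩ => f.le) ?_
    have h : y = y ⊓ sSup {z | ∃ f : z ⟶ x, S f} := by
      rw [show sSup {z | ∃ f : z ⟶ x, S f} = x from hS]
      exact (inf_eq_left.2 f.le).symm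
    refine h.le.trans (inf_sSup_eq.le.trans (iSup₂_le ?_))
    rintro z ⟨g, hg⟩
    exact le_sSup ⟨homOfLE inf_le_left, S.downward_closed hg (homOfLE inf_le_right)⟩
  transitive' x S hS R hR := by
    refine le_antisymm (sSup_le fun _ ⟨f, _⟩ => f.le) ?_
    refine (show x = sSup {z | ∃ f : z ⟶ x, S f} from hS.symm).le.trans (sSup_le ?_)
    rintro z ⟨g, hg⟩
    refine (show z = sSup {y | ∃ f : y ⟶ z, R.pullback g f} from (hR hg).symm).le.trans
      (sSup_le ?_)
    rintro y ⟨k, hk⟩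
    exact le_sSup ⟨k ≫ g, hk⟩

/-- A locale is regular when every element `l` is a join of elements `a` such that there is `t`
with `t ⊓ a = ⊥` and `t ⊔ l = ⊤`. -/
def IsRegularLocale : Prop :=
  ∀ l : L, ∃ S : Set L, sSup S = l ∧ ∀ a ∈ S, ∃ t : L, t ⊓ a = ⊥ ∧ t ⊔ l = ⊤

/-- A locale is compact when its top element is compact. -/
def IsCompactLocale : Prop :=
  IsCompactElement (⊤ : L)

end Locale

end LocalicTopos

open LocalicTopos

/-! A closed sieve on `m` is determined by the join of its domains, so `Ω(m)` is the frame of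
elements below `m`. Everything is compared with the condition that each `a : L` has a complement.

From `Idl(Ω) = Ω` to Boolean: two kinds of arrows into `(⊤, ⊤)` generate closed sieves, the vertical
`(⊤, x)` and the cartesian `(l, ⊤)`. An element `l` of `Ω(⊤)` is the least one whose restriction to
`l` is `⊤`. An isomorphism of sheaves of frames transports this, so each principal closed sieve is
also generated by some `(l, ⊤)`; if the canonical morphism is invertible, each sieve generated by
some `(l, ⊤)` is principal. Such a coincidence is very restrictive (`wellInside_self_of_mem_iff`).
An ideal `I` of `L` gives a closed sieve: the pairs `(m, S)` such that every `z ≤ S` well inside `m`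
is in `I`. Compactness and regularity make this condition local (`idealPred_sieve_isClosed`).
Testing on the ideal of elements well inside `l` and on the ideal below `x` yields `x = l` with `l`
well inside itself, that is, complemented.

From Boolean to `Idl(Ω) = Ω`: principal sieves are closed over any locale, and complements split
every `(m, y)` into a part where `y` is `⊤` and a part where it is `⊥`, so every closed sieve is
principal (`omegaToIdl_surjective`).

For `Ω = 1 ⊔ 1`: if `⊤` and `⊥` are jointly epic, double negation is the identity; conversely,
complements allow two global sections to be glued along `a` and `aᶜ`, which gives `Ω` the universal
property of the coproduct. -/

namespace LocalicTopos

/-! ### Locality for the coherent topology on `𝒢(A)`. -/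

section Total

variable {C : Type u} [Category.{v} C] {J : GrothendieckTopology C} {A : Cᵒᵖ ⥤ BddDistLat.{w}}

namespace Total

/-- A downward closed predicate on the objects of `𝒢(A)` defines a sieve on every object. -/
def sieveOfPred (X : Total A) (p : Total A → Prop) (hp : ∀ {Y Z : Total A}, (Y ⟶ Z) → p Z → p Y) :
    Sieve X where
  arrows Y _ := p Y
  downward_closed h g := hp g h

/-- A predicate which is local for the families generating the coherent topology is local for
the coherent topology. -/
theorem pred_of_mem_coherentTopology {p : Total A → Prop}
    (hjoin : ∀ (c : C) (x : A.obj (op c)) (s : Finset (A.obj (op c))), x ≤ s.sup id →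
      (∀ y ∈ s, p ⟨c, x ⊓ y⟩) → p ⟨c, x⟩)
    (hbase : ∀ (c : C) (x : A.obj (op c)) (S : Sieve c), S ∈ J c →
      (∀ (d : C) (f : d ⟶ c), S f → p ⟨d, A.map f.op x⟩) → p ⟨c, x⟩)
    {X : Total A} {S : Sieve X} (hS : S ∈ coherentTopology A J X) {Y : Total A} (g : Y ⟶ X)
    (hg : ∀ (Z : Total A) (h : Z ⟶ Y), S (h ≫ g) → p Z) : p Y := by
  have hS' := Precoverage.mem_toGrothendieck_iff.1 hS
  clear hS
  -- The statement must hold for all `Y ⟶ X` at once: the pullback case composes `g` with the arrow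
  -- pulled back along.
  induction hS' generalizing Y with
  | of X R hR =>
    replace hR : CoherentCovering A J X R := hR
    classical
    cases hR with
    | join c s =>
      -- Pulling the family back to `Y` gives joins that only dominate `Y.fib`, hence the form of
      -- `hjoin` with `x ≤ s.sup id` and `x ⊓ y`.
      refine hjoin Y.base Y.fib (s.image (A.map (Hom.base g).op)) ?_ ?_
      · refine (Hom.le g).trans ?_
        rw [Finset.sup_image, Function.id_comp]
        exact (map_finset_sup (A.map (Hom.base g).op).hom s id).le
      · intro y hy
        obtain ⟨z, hz, rfl⟩ := Finset.mem_image.1 hy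
        let b : Y.base ⟶ c := Hom.base g
        have hb : Y.fib ⊓ A.map b.op z ≤ A.map b.op z := inf_le_right
        refine hg _ (vertical inf_le_left) ⟨_,
          (⟨b, hb⟩ : Hom (⟨Y.base, Y.fib ⊓ A.map b.op z⟩ : Total A) ⟨c, z⟩), _,
          ⟨(⟨z, hz⟩ : s)⟩, Hom.ext ?_⟩
        change Hom.base g ≫ 𝟙 c = 𝟙 _ ≫ Hom.base g
        rw [Category.comp_id, Category.id_comp]
    | base c x S =>
      refine hbase Y.base Y.fib _ (J.pullback_stable (Hom.base g) S.2) ?_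
      intro d f hf
      refine hg _ (lift f Y.fib) ⟨_, (⟨𝟙 d, ?_⟩ : Hom _ ⟨d, A.map (f ≫ Hom.base g).op x⟩), _,
          ⟨(⟨d, f ≫ Hom.base g, hf⟩ : S.Arrow)⟩, Hom.ext (Category.id_comp _)⟩
      have h := OrderHomClass.mono (A.map f.op).hom (Hom.le g)
      simpa using h
  | top X => exact hg Y (𝟙 Y) trivial
  | pullback X S hS Z f ih => exact ih (g ≫ f) fun W h hW => hg W h (by simpa using hW)
  | transitive X S R hS hR ih₁ ih₂ =>
    refine ih₁ g fun Z h hZ => ih₂ hZ (𝟙 Z) fun W k hW => hg W (k ≫ h) ?_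
    simpa using hW

theorem isClosed_sieveOfPred {p : Total A → Prop} (hp : ∀ {Y Z : Total A}, (Y ⟶ Z) → p Z → p Y)
    (hjoin : ∀ (c : C) (x : A.obj (op c)) (s : Finset (A.obj (op c))), x ≤ s.sup id →
      (∀ y ∈ s, p ⟨c, x ⊓ y⟩) → p ⟨c, x⟩)
    (hbase : ∀ (c : C) (x : A.obj (op c)) (S : Sieve c), S ∈ J c →
      (∀ (d : C) (f : d ⟶ c), S f → p ⟨d, A.map f.op x⟩) → p ⟨c, x⟩) (X : Total A) :
    (coherentTopology A J).IsClosed (sieveOfPred X p hp) := by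
  intro Y f hf
  refine pred_of_mem_coherentTopology hjoin hbase hf (𝟙 Y) fun Z h hZ => ?_
  exact hZ

/-- The join family indexed by `∅` makes the empty sieve cover `(c, ⊥)`. -/
theorem mem_of_isClosed_of_eq_bot {X : Total A} {R : Sieve X}
    (hR : (coherentTopology A J).IsClosed R) {c : C} (f : (⟨c, ⊥⟩ : Total A) ⟶ X) : R f := by
  refine hR f ?_
  refine (coherentTopology A J).superset_covering ?_
    (Precoverage.generate_mem_toGrothendieck (CoherentCovering.join c ∅))
  refine (Sieve.generate_le_iff _ _).2 ?_
  rintro _ _ ⟨i⟩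
  exact absurd i.2 (Finset.notMem_empty _)

theorem mem_of_isClosed_of_cover {X : Total A} {R : Sieve X}
    (hR : (coherentTopology A J).IsClosed R) {c : C} {x : A.obj (op c)}
    (f : (⟨c, x⟩ : Total A) ⟶ X) {S : Sieve c} (hS : S ∈ J c)
    (h : ∀ (d : C) (g : d ⟶ c), S g → R (lift g x ≫ f)) : R f := by
  refine hR f ?_
  refine (coherentTopology A J).superset_covering ?_
    (Precoverage.generate_mem_toGrothendieck (CoherentCovering.base c x (⟨S, hS⟩ : J.Cover c)))
  refine (Sieve.generate_le_iff _ _).2 ?_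
  rintro _ _ ⟨i⟩
  exact h _ _ i.hf

end Total

end Total

/-! ### The frame `Ω(m)` as the elements below `m`. -/

section Locale

variable {L : Type u} [Order.Frame L]

/-- The subobject classifier of the topos of sheaves on a locale, as an internal distributive
lattice. -/
noncomputable abbrev omegaLat (L : Type u) [Order.Frame L] : Lᵒᵖ ⥤ BddDistLat.{u} :=
  (omega (localeTopology L)).toDistLatSheaf.functor

/-- The element of a locale corresponding to a closed sieve. -/
def sieveVal {m : L} (S : ClosedSieve (localeTopology L) m) : L :=
  sSup {y | ∃ f : y ⟶ m, S.1 f}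

theorem sieveVal_le {m : L} (S : ClosedSieve (localeTopology L) m) : sieveVal S ≤ m :=
  sSup_le fun _ ⟨f, _⟩ => f.le

/-- By distributivity, the meets of `k` with the domains in `S` cover `k` as soon as `k ≤ sieveVal
S`; closedness then puts `k` in `S`. -/
theorem mem_iff_le_sieveVal {m k : L} (S : ClosedSieve (localeTopology L) m) (f : k ⟶ m) :
    S.1 f ↔ k ≤ sieveVal S := by
  refine ⟨fun h => le_sSup ⟨f, h⟩, fun h => S.2 f ?_⟩
  refine le_antisymm (sSup_le fun _ ⟨f, _⟩ => f.le) ?_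
  refine (le_inf le_rfl h).trans (inf_sSup_eq.le.trans (iSup₂_le ?_))
  rintro z ⟨g, hg⟩
  exact le_sSup ⟨homOfLE inf_le_left, S.1.downward_closed hg (homOfLE inf_le_right)⟩

theorem mem_localeTopology_iff {m : L} {S : Sieve m} :
    S ∈ localeTopology L m ↔ sSup {y | ∃ f : y ⟶ m, S f} = m := Iff.rfl

theorem le_of_forall_mem_cover {m a b : L} {S : Sieve m} (hS : S ∈ localeTopology L m)
    (ha : a ≤ m) (h : ∀ (k : L) (f : k ⟶ m), S f → a ⊓ k ≤ b) : a ≤ b := by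
  refine (le_inf le_rfl (ha.trans (mem_localeTopology_iff.1 hS).ge)).trans
    (inf_sSup_eq.le.trans (iSup₂_le ?_))
  rintro z ⟨g, hg⟩
  exact h z g hg

/-- The closed sieve of the morphisms with domain below a given element. -/
def sieveBelow (m a : L) : ClosedSieve (localeTopology L) m :=
  ⟨{ arrows := fun k _ => k ≤ a
     downward_closed := fun h g => le_trans g.le h }, fun _ _ hf =>
      le_of_forall_mem_cover hf le_rfl fun _ _ h => inf_le_right.trans h⟩

theorem sieveVal_sieveBelow (m a : L) : sieveVal (sieveBelow m a) = m ⊓ a :=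
  le_antisymm (sSup_le fun _ ⟨f, hf⟩ => le_inf f.le hf)
    (le_sSup ⟨homOfLE inf_le_left, (inf_le_right : m ⊓ a ≤ a)⟩)

theorem sieveVal_le_iff {m : L} {S T : ClosedSieve (localeTopology L) m} :
    sieveVal S ≤ sieveVal T ↔ S ≤ T := by
  refine ⟨fun h k f hf => ?_, fun h => sSup_le_sSup fun _ ⟨f, hf⟩ => ⟨f, h _ hf⟩⟩
  exact (mem_iff_le_sieveVal T f).2 (((mem_iff_le_sieveVal S f).1 hf).trans h)

theorem sieveVal_injective {m : L} :
    Function.Injective (sieveVal : ClosedSieve (localeTopology L) m → L) := fun _ _ h =>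
  le_antisymm (sieveVal_le_iff.1 h.le) (sieveVal_le_iff.1 h.ge)

/-- The frame of closed sieves on `m` is the frame of elements below `m`. -/
def sieveValIso (m : L) : ClosedSieve (localeTopology L) m ≃o Set.Iic m where
  toFun S := ⟨sieveVal S, sieveVal_le S⟩
  invFun a := sieveBelow m a
  left_inv S := sieveVal_injective ((sieveVal_sieveBelow _ _).trans
    (inf_eq_right.2 (sieveVal_le S)))
  right_inv a := Subtype.ext ((sieveVal_sieveBelow _ _).trans (inf_eq_right.2 a.2))
  map_rel_iff' := sieveVal_le_iff

theorem sieveVal_pullback {m k : L} (f : k ⟶ m) (S : ClosedSieve (localeTopology L) m) :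
    sieveVal (ClosedSieve.pullback f S) = k ⊓ sieveVal S := by
  apply le_antisymm
  · refine sSup_le ?_
    rintro z ⟨g, hg⟩
    exact le_inf g.le ((mem_iff_le_sieveVal S (g ≫ f)).1 hg)
  · exact le_sSup ⟨homOfLE inf_le_left, (mem_iff_le_sieveVal S _).2 inf_le_right⟩

theorem sieveVal_top (m : L) : sieveVal (⊤ : ClosedSieve (localeTopology L) m) = m :=
  congrArg Subtype.val (map_top (sieveValIso m))

theorem sieveVal_bot (m : L) : sieveVal (⊥ : ClosedSieve (localeTopology L) m) = ⊥ :=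
  congrArg Subtype.val (map_bot (sieveValIso m))

theorem sieveVal_inf {m : L} (S T : ClosedSieve (localeTopology L) m) :
    sieveVal (S ⊓ T) = sieveVal S ⊓ sieveVal T :=
  congrArg Subtype.val (map_inf (sieveValIso m) S T)

theorem sieveVal_finset_sup {m : L} (s : Finset (ClosedSieve (localeTopology L) m)) :
    sieveVal (s.sup id) = s.sup sieveVal := by
  apply le_antisymm
  · have h : s.sup id ≤ sieveBelow m (s.sup sieveVal) := Finset.sup_le fun S hS =>
      sieveVal_le_iff.1 ((le_inf (sieveVal_le S) (Finset.le_sup hS)).trans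
        (sieveVal_sieveBelow _ _).ge)
    exact ((sieveVal_le_iff.2 h).trans (sieveVal_sieveBelow _ _).le).trans inf_le_right
  · exact Finset.sup_le fun S hS => sieveVal_le_iff.2 (Finset.le_sup (f := id) hS)

/-- Complements in `L` suffice, since `m ⊓ aᶜ` is a complement of `a` among the elements below `m`.
-/
theorem isBooleanSite_iff :
    IsBooleanSite (localeTopology L) ↔ ∀ a : L, IsCompl a aᶜ := by
  constructor
  · intro h a
    obtain ⟨b, hb⟩ := (h ⊤).exists_isCompl (sieveBelow (⊤ : L) a)
    have hb' := (sieveValIso (⊤ : L)).isCompl hb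
    have e : ((sieveValIso (⊤ : L)) (sieveBelow (⊤ : L) a)).1 = a := by
      change sieveVal _ = _
      rw [sieveVal_sieveBelow, top_inf_eq]
    have h1 : a ⊓ sieveVal b = ⊥ := by
      have := congrArg Subtype.val hb'.inf_eq_bot
      rw [← e]; exact this
    have h2 : a ⊔ sieveVal b = ⊤ := by
      have := congrArg Subtype.val hb'.sup_eq_top
      rw [← e]; exact this
    have h3 : IsCompl a (sieveVal b) := IsCompl.of_eq h1 h2
    rwa [h3.compl_eq]
  · intro h m
    refine ⟨fun S => ⟨sieveBelow m (sieveVal S : L)ᶜ, ?_⟩⟩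
    refine (OrderIso.isCompl_iff (sieveValIso m)).2 (IsCompl.of_eq (Subtype.ext ?_) (Subtype.ext ?_))
    · change sieveVal S ⊓ sieveVal (sieveBelow m (sieveVal S)ᶜ) = ⊥
      rw [sieveVal_sieveBelow, inf_left_comm, inf_compl_self, inf_bot_eq]
    · change sieveVal S ⊔ sieveVal (sieveBelow m (sieveVal S)ᶜ) = m
      rw [sieveVal_sieveBelow, sup_inf_left, (h _).sup_eq_top, inf_top_eq]
      exact sup_eq_right.2 (sieveVal_le S)

/-! ### The well-inside relation and ideals in a compact regular locale. -/

open Total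

/-- `a` is well inside `l` when `l` contains a neighbourhood of the closure of `a`. -/
def WellInside (a l : L) : Prop :=
  ∃ t : L, t ⊓ a = ⊥ ∧ t ⊔ l = ⊤

theorem WellInside.mono {a b l m : L} (h : WellInside b l) (hab : a ≤ b) (hlm : l ≤ m) :
    WellInside a m := by
  obtain ⟨t, ht, ht'⟩ := h
  exact ⟨t, le_bot_iff.1 ((inf_le_inf_left t hab).trans ht.le),
    top_le_iff.1 (ht'.ge.trans (sup_le_sup_left hlm t))⟩

theorem WellInside.le {a l : L} (h : WellInside a l) : a ≤ l := by
  obtain ⟨t, ht, ht'⟩ := h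
  refine (le_inf le_rfl (le_top.trans ht'.ge)).trans ?_
  rw [inf_sup_left, inf_comm a t, ht, bot_sup_eq]
  exact inf_le_right

theorem WellInside.sup {a b l : L} (ha : WellInside a l) (hb : WellInside b l) :
    WellInside (a ⊔ b) l := by
  obtain ⟨t, ht, ht'⟩ := ha
  obtain ⟨r, hr, hr'⟩ := hb
  refine ⟨t ⊓ r, ?_, ?_⟩
  · rw [inf_sup_left, inf_right_comm, ht, bot_inf_eq, inf_assoc, hr, inf_bot_eq, sup_bot_eq]
  · rw [sup_inf_right, ht', hr', inf_top_eq]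

theorem WellInside.isCompl_compl {a : L} (h : WellInside a a) : IsCompl a aᶜ := by
  obtain ⟨t, ht, ht'⟩ := h
  have h' : IsCompl a t := IsCompl.of_eq (inf_comm a t ▸ ht) (sup_comm a t ▸ ht')
  rwa [h'.compl_eq]

/-- The ideal of elements well inside a given element. -/
def wellInsideIdeal (l : L) : Order.Ideal L where
  carrier := {a | WellInside a l}
  lower' _ _ hba ha := WellInside.mono ha hba le_rfl
  nonempty' := ⟨⊥, ⊤, inf_bot_eq _, top_sup_eq _⟩
  directed' a ha b hb := ⟨a ⊔ b, WellInside.sup ha hb, le_sup_left, le_sup_right⟩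

theorem le_of_forall_wellInside (hreg : IsRegularLocale L) {l x : L}
    (h : ∀ a, WellInside a l → a ≤ x) : l ≤ x := by
  obtain ⟨S, hS, hS'⟩ := hreg l
  rw [← hS]
  exact sSup_le fun a ha => h a (hS' a ha)

/-- In a compact regular locale, membership of an ideal may be checked on a cover of an element
in which the given element is well inside. -/
theorem mem_ideal_of_wellInside (hreg : IsRegularLocale L) (hcomp : IsCompactLocale L)
    (I : Order.Ideal L) {z m : L} (hz : WellInside z m) {S : Set L} (hS : sSup S = m)
    (h : ∀ k ∈ S, ∀ a, WellInside a k → a ≤ z → a ∈ I) : z ∈ I := by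
  obtain ⟨t, ht, ht'⟩ := hz
  -- By regularity `D` still has join at least `m`, so `D` together with `t` covers `⊤` and
  -- compactness applies. In the resulting finite cover of `z`, the piece `z ⊓ t` is `⊥`.
  let D : Set L := {a | ∃ k ∈ S, WellInside a k}
  have hm : m ≤ sSup D := hS.ge.trans (sSup_le fun k hk =>
    le_of_forall_wellInside hreg fun a ha => le_sSup ⟨k, hk, ha⟩)
  have hD : (⊤ : L) ≤ sSup (insert t D) := by
    rw [sSup_insert, ← ht']
    exact sup_le_sup_left hm t
  obtain ⟨s, hs, hs'⟩ :=
    (CompleteLattice.isCompactElement_iff_exists_le_sSup_of_le_sSup L ⊤).1 hcomp _ hD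
  have e : z ≤ s.sup fun a => z ⊓ a := by
    refine (le_inf le_rfl (le_top.trans hs')).trans ?_
    rw [Finset.sup_inf_distrib_left]
    rfl
  refine I.lower e ((I.finsetSup_mem_iff).2 fun a ha => ?_)
  rcases hs ha with rfl | ⟨k, hk, hak⟩
  · rw [inf_comm, ht]
    exact I.bot_mem
  · exact h k hk _ (hak.mono inf_le_right le_rfl) inf_le_left

/-! ### Closed sieves on `𝒢(Ω)` attached to ideals of `L`. -/

instance (A : Lᵒᵖ ⥤ BddDistLat.{w}) (Y X : Total A) : Subsingleton (Y ⟶ X) :=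
  ⟨fun _ _ => Hom.ext (Subsingleton.elim _ _)⟩

/-- The objects `(m, S)` of `𝒢(Ω)` such that all elements of `S` well inside `m` belong to `I`. -/
def idealPred (I : Order.Ideal L) (Y : Total (omegaLat L)) : Prop :=
  ∀ z : L, WellInside z Y.base → z ≤ sieveVal Y.fib → z ∈ I

theorem sieveVal_fib_le {Y Z : Total (omegaLat L)} (f : Y ⟶ Z) :
    sieveVal Y.fib ≤ sieveVal Z.fib :=
  (sieveVal_le_iff.2 (Hom.le f)).trans ((sieveVal_pullback (Hom.base f) Z.fib).le.trans
    inf_le_right)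

theorem idealPred_downward {I : Order.Ideal L} {Y Z : Total (omegaLat L)} (f : Y ⟶ Z)
    (h : idealPred I Z) : idealPred I Y := fun z hz hz' =>
  h z (hz.mono le_rfl (Hom.base f).le) (hz'.trans (sieveVal_fib_le f))

/-- Membership of `S` in `I` need not be local for infinite covers. Testing only elements well
inside the base repairs this, because for them a cover of the base can be replaced by a finite one;
finite joins are handled by distributivity. -/
theorem idealPred_sieve_isClosed (hreg : IsRegularLocale L) (hcomp : IsCompactLocale L)
    (I : Order.Ideal L) (X : Total (omegaLat L)) :
    (coherentTopology (omegaLat L) (localeTopology L)).IsClosed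
      (sieveOfPred X (idealPred I) idealPred_downward) := by
  apply isClosed_sieveOfPred
  · intro m x s hx h z hz hzx
    have e : z ≤ s.sup fun y => z ⊓ sieveVal y := by
      have hxs : sieveVal x ≤ s.sup sieveVal :=
        (sieveVal_le_iff.2 hx).trans (sieveVal_finset_sup s).le
      refine (le_inf le_rfl (hzx.trans hxs)).trans ?_
      exact (Finset.sup_inf_distrib_left s sieveVal z).le
    refine I.lower e ((I.finsetSup_mem_iff).2 fun y hy => ?_)
    refine h y hy _ (hz.mono inf_le_left le_rfl) ?_
    exact (inf_le_inf_right _ hzx).trans (sieveVal_inf x y).ge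
  · intro m x S hS h z hz hzx
    refine mem_ideal_of_wellInside hreg hcomp I hz (mem_localeTopology_iff.1 hS) ?_
    rintro k ⟨f, hf⟩ a ha haz
    refine h k f hf a ha ?_
    refine (le_inf ?_ (haz.trans hzx)).trans (sieveVal_pullback f x).ge
    exact ha.le

/-- If a principal ideal of `Ω` coincides with the one of an element of the locale, then this
element is complemented. -/
theorem wellInside_self_of_mem_iff (hreg : IsRegularLocale L) (hcomp : IsCompactLocale L)
    (x : (omegaLat L).obj (op ⊤)) (l : L)
    (h : ∀ R : Sieve (⟨⊤, ⊤⟩ : Total (omegaLat L)),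
      (coherentTopology (omegaLat L) (localeTopology L)).IsClosed R →
      (R.arrows (vertical (le_top : x ≤ ⊤)) ↔
        R.arrows ((Total.top (omegaLat L)).map (homOfLE le_top : l ⟶ ⊤)))) :
    sieveVal x = l ∧ WellInside l l := by
  -- The sieve of this ideal contains `(l, ⊤)` by construction. It therefore contains `(⊤, x)`, and
  -- `x` itself may be tested since every element is well inside `⊤`, with witness `⊥`.
  have h₁ : WellInside (sieveVal x) l :=
    (h _ (idealPred_sieve_isClosed hreg hcomp (wellInsideIdeal l) _)).2
      (fun z hz _ => hz) (sieveVal x) ⟨⊥, bot_inf_eq _, bot_sup_eq _⟩ le_rfl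
  -- Here the sieve contains `(⊤, x)` by construction, hence `(l, ⊤)`; regularity then turns the
  -- conclusion into `l ≤ x`.
  have h₂ : ∀ z, WellInside z l → z ≤ l → z ≤ sieveVal x := fun z hz hzl =>
    (h _ (idealPred_sieve_isClosed hreg hcomp (Order.Ideal.principal (sieveVal x)) _)).1
      (fun z _ hz => hz) z hz (hzl.trans (sieveVal_top l).ge)
  have e : sieveVal x = l := le_antisymm (h₁.le)
    (le_of_forall_wellInside hreg fun z hz => h₂ z hz (hz.le))
  exact ⟨e, e ▸ h₁⟩

end Locale

/-! ### From `Idl(Ω) = Ω` to complements. -/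

section Principal

variable {C : Type u} [Category.{v} C] {J : GrothendieckTopology C} {A : Cᵒᵖ ⥤ BddDistLat.{w}}

/-- Expresses a principal closed sieve by the closed sieves containing its generator, the form
needed for `wellInside_self_of_mem_iff`. -/
theorem close_principalSieve_le_iff {c : C} (x : A.obj (op c)) {R : Sieve (⟨c, ⊤⟩ : Total A)}
    (hR : (Total.coherentTopology A J).IsClosed R) :
    (Total.coherentTopology A J).close (principalSieve A x) ≤ R ↔
      R.arrows (Total.vertical (le_top : x ≤ ⊤)) := by
  constructor
  · intro h
    exact h _ ((Total.coherentTopology A J).le_close _ _ (Sieve.le_generate _ _ _ (Presieve.singleton_self _)))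
  · intro h
    refine GrothendieckTopology.le_close_of_isClosed _ ?_ hR
    refine (Sieve.generate_le_iff _ _).2 ?_
    rintro _ _ ⟨⟩
    exact h

end Principal

section Locale

variable {L : Type u} [Order.Frame L]

open Total

theorem wellInside_self_of_isIsomorphic (hreg : IsRegularLocale L) (hcomp : IsCompactLocale L)
    (h : (idl (omega (localeTopology L)).toDistLatSheaf).IsIsomorphic (omega (localeTopology L)))
    (a : L) : WellInside a a := by
  obtain ⟨φ⟩ := h
  let X := ClosedSieve (coherentTopology (omegaLat L) (localeTopology L))
    ((Total.top (omegaLat L)).obj ⊤)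
  let x : (omegaLat L).obj (op ⊤) := sieveBelow (⊤ : L) a
  let S : X := ⟨(coherentTopology (omegaLat L) (localeTopology L)).close
    (principalSieve (omegaLat L) x), GrothendieckTopology.close_isClosed _ _⟩
  let e (m : L) : ClosedSieve (coherentTopology (omegaLat L) (localeTopology L))
      ((Total.top (omegaLat L)).obj m) ≃o ClosedSieve (localeTopology L) m :=
    { toFun := (φ.hom.app (op m)).hom
      invFun := (φ.inv.app (op m)).hom
      left_inv := fun R => ConcreteCategory.congr_hom (φ.hom_inv_id_app (op m)) R
      right_inv := fun R => ConcreteCategory.congr_hom (φ.inv_hom_id_app (op m)) R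
      map_rel_iff' := by
        intro R T
        refine ⟨fun hRT => ?_, fun hRT => OrderHomClass.mono (φ.hom.app (op m)).hom hRT⟩
        have := OrderHomClass.mono (φ.inv.app (op m)).hom hRT
        have e₁ := ConcreteCategory.congr_hom (φ.hom_inv_id_app (op m)) R
        have e₂ := ConcreteCategory.congr_hom (φ.hom_inv_id_app (op m)) T
        exact e₁.ge.trans (this.trans e₂.le) }
  have nat (m : L) (R : X) : e m (ClosedSieve.pullback
      ((Total.top (omegaLat L)).map (homOfLE le_top : m ⟶ ⊤)) R) =
      ClosedSieve.pullback (homOfLE le_top : m ⟶ ⊤) (e ⊤ R) :=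
    ConcreteCategory.congr_hom (φ.hom.naturality (homOfLE le_top : m ⟶ ⊤).op) R
  -- With `l = sieveVal (e ⊤ S)`: `S ≤ R` means `l ≤ e ⊤ R`, that is, `e ⊤ R` restricts to `⊤` on
  -- `l`. By naturality so does `R`, which says that `R` contains the arrow from `(l, ⊤)`.
  have key := wellInside_self_of_mem_iff hreg hcomp x (sieveVal (e ⊤ S)) (by
    intro R hR
    let R' : X := ⟨R, hR⟩
    rw [← close_principalSieve_le_iff x hR]
    change S ≤ R' ↔ _
    rw [← (e ⊤).le_iff_le, ← sieveVal_le_iff]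
    refine Iff.trans ?_ (Sieve.mem_iff_pullback_eq_top _).symm
    generalize sieveVal (e ⊤ S) = l
    have h₁ : R.pullback ((Total.top (omegaLat L)).map (homOfLE le_top : l ⟶ ⊤)) = ⊤ ↔
      ClosedSieve.pullback ((Total.top (omegaLat L)).map (homOfLE le_top : l ⟶ ⊤)) R' = ⊤ :=
      ⟨fun h => Subtype.ext h, fun h => congrArg Subtype.val h⟩
    refine Iff.trans ?_ h₁.symm
    rw [← (e l).injective.eq_iff, nat, map_top, ← sieveVal_injective.eq_iff,
      sieveVal_pullback, sieveVal_top, inf_eq_left])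
  have hx : sieveVal x = a := (sieveVal_sieveBelow _ _).trans (top_inf_eq _)
  rw [← key.1, hx] at key
  exact key.2

theorem isBooleanSite_of_isIsomorphic (hreg : IsRegularLocale L) (hcomp : IsCompactLocale L)
    (h : (idl (omega (localeTopology L)).toDistLatSheaf).IsIsomorphic (omega (localeTopology L))) :
    IsBooleanSite (localeTopology L) :=
  isBooleanSite_iff.2 fun a => (wellInside_self_of_isIsomorphic hreg hcomp h a).isCompl_compl

theorem isBooleanSite_of_isIso_toIdl (hreg : IsRegularLocale L) (hcomp : IsCompactLocale L)
    (h : IsIso (toIdl (omega (localeTopology L)).toDistLatSheaf)) :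
    IsBooleanSite (localeTopology L) := by
  refine isBooleanSite_iff.2 fun a => WellInside.isCompl_compl ?_
  let f := toIdl (omega (localeTopology L)).toDistLatSheaf
  let K := coherentTopology (omegaLat L) (localeTopology L)
  let i := (Total.top (omegaLat L)).map (homOfLE le_top : a ⟶ ⊤)
  -- The sieve generated by `(a, ⊤)`, and below it a preimage `x`: then `(⊤, x)` and `(a, ⊤)` lie in
  -- the same closed sieves.
  let S : ClosedSieve K ((Total.top (omegaLat L)).obj ⊤) :=
    ⟨K.close (Sieve.generate (Presieve.singleton i)), GrothendieckTopology.close_isClosed _ _⟩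
  let x : (omegaLat L).obj (op ⊤) := (inv f).hom.app (op ⊤) S
  have hf : (inv f ≫ f).hom.app (op ⊤) = 𝟙 _ := by
    rw [IsIso.inv_hom_id]
    rfl
  have hx : f.hom.app (op ⊤) x = S := ConcreteCategory.congr_hom hf S
  have hx' : K.close (principalSieve (omegaLat L) x) =
    K.close (Sieve.generate (Presieve.singleton i)) := congrArg Subtype.val hx
  refine (wellInside_self_of_mem_iff hreg hcomp x a fun R hR => ?_).2
  rw [← close_principalSieve_le_iff x hR, hx']
  constructor
  · intro h
    exact h _ (K.le_close _ _ (Sieve.le_generate _ _ _ (Presieve.singleton_self _)))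
  · intro h
    refine GrothendieckTopology.le_close_of_isClosed _ ?_ hR
    refine (Sieve.generate_le_iff _ _).2 ?_
    rintro _ _ ⟨⟩
    exact h

/-! ### `Idl(Ω) = Ω` over a Boolean locale. -/

theorem principalSieve_omega_apply {c : L} (x : (omegaLat L).obj (op c))
    {Y : Total (omegaLat L)} (g : Y ⟶ (⟨c, ⊤⟩ : Total (omegaLat L))) :
    (principalSieve (omegaLat L) x).arrows g ↔ sieveVal Y.fib ≤ sieveVal x := by
  refine (principalSieve_apply (omegaLat L) x g).trans ?_
  refine (sieveVal_le_iff (T := ClosedSieve.pullback (Hom.base g) x)).symm.trans ?_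
  refine (iff_of_eq (congrArg (sieveVal Y.fib ≤ ·) (sieveVal_pullback (Hom.base g) x))).trans ?_
  exact le_inf_iff.trans (and_iff_right (sieveVal_le _))

/-- Principal ideals of `Ω` are closed. -/
theorem principalSieve_isClosed {c : L} (x : (omegaLat L).obj (op c)) :
    (coherentTopology (omegaLat L) (localeTopology L)).IsClosed
      (principalSieve (omegaLat L) x) := by
  have e : principalSieve (omegaLat L) x =
      sieveOfPred _ (fun Y => sieveVal Y.fib ≤ sieveVal x)
        (fun f h => (sieveVal_fib_le f).trans h) := by
    apply Sieve.ext
    intro Y g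
    exact principalSieve_omega_apply x g
  rw [e]
  apply isClosed_sieveOfPred
  · intro m y s hy h
    have hys : sieveVal y ≤ s.sup sieveVal :=
      (sieveVal_le_iff.2 hy).trans (sieveVal_finset_sup s).le
    refine (le_inf le_rfl hys).trans ?_
    refine (Finset.sup_inf_distrib_left s sieveVal _).le.trans (Finset.sup_le fun z hz => ?_)
    exact (sieveVal_inf y z).ge.trans (h z hz)
  · intro m y S hS h
    refine le_of_forall_mem_cover hS (sieveVal_le y) fun k f hf => ?_
    rw [inf_comm]
    exact (sieveVal_pullback f y).ge.trans (h k f hf)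

theorem close_principalSieve {c : L} (x : (omegaLat L).obj (op c)) :
    (coherentTopology (omegaLat L) (localeTopology L)).close (principalSieve (omegaLat L) x) =
      principalSieve (omegaLat L) x :=
  (GrothendieckTopology.isClosed_iff_close_eq_self _ _).1 (principalSieve_isClosed x)

/-- The canonical morphism `Ω ⟶ Idl(Ω)` at an object. -/
noncomputable def omegaToIdl (c : L) (x : ClosedSieve (localeTopology L) c) :
    ClosedSieve (coherentTopology (omegaLat L) (localeTopology L))
      ((Total.top (omegaLat L)).obj c) :=
  ⟨(coherentTopology (omegaLat L) (localeTopology L)).close (principalSieve (omegaLat L)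
    (c := c) x), GrothendieckTopology.close_isClosed _ _⟩

theorem omegaToIdl_le_iff {c : L} {x y : ClosedSieve (localeTopology L) c} :
    omegaToIdl c x ≤ omegaToIdl c y ↔ x ≤ y := by
  refine (close_principalSieve_le_iff (c := c) (A := omegaLat L) x (omegaToIdl c y).2).trans ?_
  refine (iff_of_eq (congrArg (fun S : Sieve _ => S.arrows _)
    (close_principalSieve (c := c) y))).trans ?_
  exact (principalSieve_omega_apply (c := c) y _).trans sieveVal_le_iff

/-- `𝒢(A)` is thin over a locale, so membership depends only on the domain of the arrow. -/
theorem mem_sieve_congr {A : Lᵒᵖ ⥤ BddDistLat.{w}} {X Y : Total A} {R : Sieve X} {f : Y ⟶ X}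
    (h : R f) (g : Y ⟶ X) : R g :=
  Subsingleton.elim f g ▸ h

theorem omegaToIdl_surjective (h : IsBooleanSite (localeTopology L)) (c : L) :
    Function.Surjective (omegaToIdl c) := by
  intro R
  let D : Set L := {m | ∃ f : m ⟶ c, R.1 ((Total.top (omegaLat L)).map f)}
  -- `R` is closed under covers of the base, so `sSup D` again belongs to `D`; it is the element
  -- whose principal sieve is `R`.
  have hD : ∀ {w : L}, w ≤ sSup D → ∀ f : w ⟶ c, R.1 ((Total.top (omegaLat L)).map f) := by
    intro w hw f
    let S : Sieve w :=
      { arrows := fun k _ => ∃ m ∈ D, k ≤ m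
        downward_closed := fun ⟨m, hm, hk⟩ g => ⟨m, hm, le_trans g.le hk⟩ }
    refine mem_of_isClosed_of_cover (S := S) R.2 _ ?_ ?_
    · refine le_antisymm (sSup_le fun _ ⟨f, _⟩ => f.le) ?_
      refine (le_inf le_rfl hw).trans (inf_sSup_eq.le.trans (iSup₂_le fun m hm => ?_))
      exact le_sSup ⟨homOfLE inf_le_left, m, hm, inf_le_right⟩
    · rintro k g ⟨m, ⟨f', hm⟩, hk⟩
      have h₁ := R.1.downward_closed hm ((Total.top (omegaLat L)).map (homOfLE hk))
      let p : (⟨k, (omegaLat L).map g.op ⊤⟩ : Total (omegaLat L)) ⟶ ⟨k, ⊤⟩ := vertical le_top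
      have h₂ := R.1.downward_closed h₁ p
      exact mem_sieve_congr h₂ _
  refine ⟨sieveBelow c (sSup D), Subtype.ext ((close_principalSieve _).trans (Sieve.ext ?_))⟩
  intro Y g
  refine (principalSieve_omega_apply (c := c) (sieveBelow c (sSup D)) g).trans ?_
  have hgc : Y.base ≤ c := (Hom.base g).le
  rw [sieveVal_sieveBelow]
  refine (le_inf_iff.trans (and_iff_right ((sieveVal_le Y.fib).trans hgc))).trans ?_
  obtain ⟨m, y⟩ := Y
  have hym : sieveVal y ≤ m := sieveVal_le y
  constructor
  · intro hy
    -- The base `m` is covered by `y` and its complement. Over the first part the pair lies below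
    -- some `(k, ⊤)` already in `R`; over the second the fibre is `⊥`, which the empty family
    -- covers.
    let S : Sieve m :=
      { arrows := fun k _ => k ≤ sieveVal y ∨ k ⊓ sieveVal y = ⊥
        downward_closed := fun hk g => hk.imp (fun hk => le_trans g.le hk)
          fun hk => le_bot_iff.1 ((inf_le_inf_right _ g.le).trans hk.le) }
    refine mem_of_isClosed_of_cover (S := S) R.2 g ?_ ?_
    · refine le_antisymm (sSup_le fun _ ⟨f, _⟩ => f.le) ?_
      have hm : m ≤ sieveVal y ⊔ (m ⊓ (sieveVal y)ᶜ) := by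
        rw [sup_inf_left, (isBooleanSite_iff.1 h _).sup_eq_top, inf_top_eq]
        exact le_sup_right
      refine hm.trans (sup_le ?_ ?_)
      · exact le_sSup ⟨homOfLE (sieveVal_le _), Or.inl le_rfl⟩
      · refine le_sSup ⟨homOfLE inf_le_left, Or.inr ?_⟩
        rw [inf_assoc, inf_comm _ (sieveVal y), inf_compl_self, inf_bot_eq]
    · rintro k f (hk | hk)
      · have h₁ := hD (hk.trans hy) (homOfLE ((hk.trans hym).trans hgc))
        let p : (⟨k, (omegaLat L).map f.op y⟩ : Total (omegaLat L)) ⟶ ⟨k, ⊤⟩ := vertical le_top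
        have h₂ := R.1.downward_closed h₁ p
        exact mem_sieve_congr h₂ _
      · have e : (omegaLat L).map f.op y = ⊥ := by
          refine sieveVal_injective ((sieveVal_pullback f y).trans (hk.trans ?_))
          exact (sieveVal_bot _).symm
        have : ∀ (z : (omegaLat L).obj (op k)) (_ : z = ⊥)
            (i : (⟨k, z⟩ : Total (omegaLat L)) ⟶ ⟨c, ⊤⟩), R.1.arrows i := by
          rintro _ rfl i
          exact mem_of_isClosed_of_eq_bot R.2 i
        exact this _ e _
  · intro hy
    -- Restricting `y` to itself gives `⊤`, so `(y, ⊤)` maps to `(m, y)`; this direction needs no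
    -- complements.
    let q : (⟨sieveVal y, ⊤⟩ : Total (omegaLat L)) ⟶ ⟨m, y⟩ :=
      (⟨homOfLE hym, sieveVal_le_iff.1 ((sieveVal_top (sieveVal y)).le.trans
        ((le_inf le_rfl le_rfl).trans (sieveVal_pullback (homOfLE hym) y).ge))⟩ :
        Hom (⟨sieveVal y, ⊤⟩ : Total (omegaLat L)) ⟨m, y⟩)
    refine le_sSup ⟨homOfLE (hym.trans hgc), ?_⟩
    exact mem_sieve_congr (R.1.downward_closed hy q) _

/-- Over a Boolean locale, `Ω` is its own ideal completion. -/
noncomputable def omegaIsoIdl (h : IsBooleanSite (localeTopology L)) (c : L) :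
    ClosedSieve (localeTopology L) c ≃o
      ClosedSieve (coherentTopology (omegaLat L) (localeTopology L))
        ((Total.top (omegaLat L)).obj c) :=
  OrderIso.ofSurjective (OrderEmbedding.ofMapLEIff (omegaToIdl c) fun _ _ => omegaToIdl_le_iff)
    (omegaToIdl_surjective h c)

theorem isIsomorphic_of_isBooleanSite (h : IsBooleanSite (localeTopology L)) :
    (idl (omega (localeTopology L)).toDistLatSheaf).IsIsomorphic (omega (localeTopology L)) := by
  refine ⟨Iso.symm (NatIso.ofComponents (fun c => ?_) ?_)⟩
  · let f : FrameHom (ClosedSieve (localeTopology L) c.unop)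
        (ClosedSieve (coherentTopology (omegaLat L) (localeTopology L))
          ((Total.top (omegaLat L)).obj c.unop)) := omegaIsoIdl h c.unop
    let g : FrameHom (ClosedSieve (coherentTopology (omegaLat L) (localeTopology L))
          ((Total.top (omegaLat L)).obj c.unop))
        (ClosedSieve (localeTopology L) c.unop) := (omegaIsoIdl h c.unop).symm
    exact
      { hom := Frm.ofHom f
        inv := Frm.ofHom g
        hom_inv_id := Frm.ext fun x => (omegaIsoIdl h c.unop).symm_apply_apply x
        inv_hom_id := Frm.ext fun x => (omegaIsoIdl h c.unop).apply_symm_apply x }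
  · intro c d f
    apply Frm.ext
    intro x
    exact ConcreteCategory.congr_hom
      ((toIdl (omega (localeTopology L)).toDistLatSheaf).hom.naturality f) x

theorem isIso_toIdl_of_isBooleanSite (h : IsBooleanSite (localeTopology L)) :
    IsIso (toIdl (omega (localeTopology L)).toDistLatSheaf) := by
  have : ∀ c, IsIso ((toIdl (omega (localeTopology L)).toDistLatSheaf).hom.app c) := fun c =>
    (isIso_iff_bijective _).2 (omegaIsoIdl h c.unop).bijective
  have : IsIso (toIdl (omega (localeTopology L)).toDistLatSheaf).hom := NatIso.isIso_of_isIso_app _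
  have : IsIso ((sheafToPresheaf _ _).map (toIdl (omega (localeTopology L)).toDistLatSheaf)) := this
  exact isIso_of_reflects_iso (toIdl (omega (localeTopology L)).toDistLatSheaf)
    (sheafToPresheaf _ _)

/-! ### From `Ω = 1 ⊔ 1` to Boolean. -/

/-- Double negation on the subobject classifier. -/
noncomputable def notNot (L : Type u) [Order.Frame L] :
    (omega (localeTopology L)).sheaf ⟶ (omega (localeTopology L)).sheaf where
  hom :=
    { app := fun c => ↾fun S : ClosedSieve (localeTopology L) c.unop =>
        (sieveBelow c.unop (sieveVal S)ᶜᶜ : ClosedSieve (localeTopology L) c.unop)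
      naturality := by
        intro c d f
        ext S
        apply sieveVal_injective
        change ClosedSieve (localeTopology L) c.unop at S
        change sieveVal (sieveBelow d.unop (sieveVal (ClosedSieve.pullback f.unop S))ᶜᶜ) =
          sieveVal (ClosedSieve.pullback f.unop (sieveBelow c.unop (sieveVal S)ᶜᶜ))
        -- Restriction is a meet with `d`; double negation preserves meets, and `d ≤ dᶜᶜ` absorbs
        -- the extra factor.
        rw [sieveVal_sieveBelow, sieveVal_pullback, sieveVal_pullback, sieveVal_sieveBelow,
          compl_compl_inf_distrib, ← inf_assoc, ← inf_assoc, inf_eq_left.2 le_compl_compl,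
          inf_eq_left.2 f.unop.le] }

theorem topMap_notNot :
    (omega (localeTopology L)).toDistLatSheaf.topMap ≫ notNot L =
      (omega (localeTopology L)).toDistLatSheaf.topMap := by
  apply Sheaf.hom_ext
  ext c x
  apply sieveVal_injective
  change sieveVal (sieveBelow c.unop (sieveVal (⊤ : ClosedSieve (localeTopology L) c.unop))ᶜᶜ) =
    sieveVal (⊤ : ClosedSieve (localeTopology L) c.unop)
  rw [sieveVal_sieveBelow, sieveVal_top]
  exact inf_eq_left.2 le_compl_compl

theorem botMap_notNot :
    (omega (localeTopology L)).toDistLatSheaf.botMap ≫ notNot L =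
      (omega (localeTopology L)).toDistLatSheaf.botMap := by
  apply Sheaf.hom_ext
  ext c x
  apply sieveVal_injective
  change sieveVal (sieveBelow c.unop (sieveVal (⊥ : ClosedSieve (localeTopology L) c.unop))ᶜᶜ) =
    sieveVal (⊥ : ClosedSieve (localeTopology L) c.unop)
  rw [sieveVal_sieveBelow, sieveVal_bot, compl_bot, compl_top, inf_bot_eq]

/-- Double negation fixes `⊤` and `⊥`, so it agrees with the identity after the epimorphism
`twoToOmega`. -/
theorem isBooleanSite_of_isIso_twoToOmega (h : IsIso (twoToOmega (localeTopology L))) :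
    IsBooleanSite (localeTopology L) := by
  have e : notNot L = 𝟙 _ := by
    rw [← cancel_epi (twoToOmega (localeTopology L)), Category.comp_id, twoToOmega]
    apply coprod.hom_ext
    · rw [coprod.inl_desc_assoc, coprod.inl_desc, topMap_notNot]
    · rw [coprod.inr_desc_assoc, coprod.inr_desc, botMap_notNot]
  have hcc (a : L) : aᶜᶜ = a := by
    have h₁ : (notNot L).hom.app (op ⊤) = 𝟙 _ := by
      rw [e]
      rfl
    have h₂ : sieveBelow (⊤ : L) (sieveVal (sieveBelow (⊤ : L) a))ᶜᶜ = sieveBelow (⊤ : L) a :=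
      ConcreteCategory.congr_hom h₁ (sieveBelow (⊤ : L) a)
    have h₃ := congrArg sieveVal h₂
    simpa only [sieveVal_sieveBelow, top_inf_eq] using h₃
  refine isBooleanSite_iff.2 fun a => IsCompl.of_eq (inf_compl_self a) ?_
  rw [← hcc (a ⊔ aᶜ), compl_sup, inf_compl_self, compl_bot]

/-! ### From Boolean to `Ω = 1 ⊔ 1`: gluing along complements. -/

theorem sheaf_section_ext (F : Sheaf (localeTopology L) (Type w)) {c : L} {S : Sieve c}
    (hS : S ∈ localeTopology L c) {x y : F.obj.obj (op c)}
    (h : ∀ (d : L) (f : d ⟶ c), S f → F.obj.map f.op x = F.obj.map f.op y) : x = y :=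
  ((isSheaf_iff_isSheaf_of_type _ _).1 F.property S hS).isSeparatedFor.ext h

/-- The empty sieve covers `⊥`. -/
theorem sheaf_section_ext_of_le_bot (F : Sheaf (localeTopology L) (Type w)) {c : L}
    (hc : c ≤ ⊥) (x y : F.obj.obj (op c)) : x = y := by
  refine sheaf_section_ext F (S := ⊥) ?_ fun d f hf => hf.elim
  exact le_antisymm (sSup_le fun _ ⟨f, _⟩ => f.le) (hc.trans bot_le)

/-- The sieve of the morphisms whose domain is below `a` or `b`. -/
def sieveBelowOr (c a b : L) : Sieve c where
  arrows k _ := k ≤ a ∨ k ≤ b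
  downward_closed hk g := hk.imp (le_trans g.le) (le_trans g.le)

theorem sieveBelowOr_mem {c a b : L} (h : a ⊔ b = ⊤) :
    sieveBelowOr c a b ∈ localeTopology L c := by
  refine le_antisymm (sSup_le fun _ ⟨f, _⟩ => f.le) ?_
  refine (le_inf le_rfl (le_top.trans h.ge)).trans ((inf_sup_left c a b).le.trans (sup_le ?_ ?_))
  · exact le_sSup ⟨homOfLE inf_le_left, Or.inl inf_le_right⟩
  · exact le_sSup ⟨homOfLE inf_le_left, Or.inr inf_le_right⟩

/-- The terminal sheaf has exactly one section over every object. -/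
noncomputable abbrev terminalSectionUnique (c : Lᵒᵖ) :
    Unique ((⊤_ (Sheaf (localeTopology L) (Type u))).obj.obj c) :=
  Types.isTerminalEquivUnique _ (terminalIsTerminal.isTerminalObj
    (sheafToPresheaf (localeTopology L) (Type u) ⋙ (evaluation _ _).obj c) _)

/-- The sections of a sheaf determined by a global section. -/
noncomputable def globalSection {F : Sheaf (localeTopology L) (Type u)}
    (s : ⊤_ (Sheaf (localeTopology L) (Type u)) ⟶ F) (c : L) : F.obj.obj (op c) :=
  s.hom.app (op c) (terminalSectionUnique (op c)).default

theorem map_globalSection {F : Sheaf (localeTopology L) (Type u)}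
    (s : ⊤_ (Sheaf (localeTopology L) (Type u)) ⟶ F) {c d : L} (f : d ⟶ c) :
    F.obj.map f.op (globalSection s c) = globalSection s d := by
  refine (ConcreteCategory.congr_hom (s.hom.naturality f.op) _).symm.trans ?_
  exact congrArg (s.hom.app (op d)) ((terminalSectionUnique (op d)).uniq _)

theorem globalSection_injective {F : Sheaf (localeTopology L) (Type u)}
    {s t : ⊤_ (Sheaf (localeTopology L) (Type u)) ⟶ F}
    (h : ∀ c, globalSection s c = globalSection t c) : s = t := by
  apply Sheaf.hom_ext
  ext c x
  rw [(terminalSectionUnique c).uniq x]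
  exact h c.unop

/-- `x` restricts to `s` below `a` and to `t` below `b`. -/
def IsGluing {F : Sheaf (localeTopology L) (Type u)}
    (s t : ⊤_ (Sheaf (localeTopology L) (Type u)) ⟶ F) (a b : L) {c : L}
    (x : F.obj.obj (op c)) : Prop :=
  ∀ (k : L) (f : k ⟶ c), (k ≤ a → F.obj.map f.op x = globalSection s k) ∧
    (k ≤ b → F.obj.map f.op x = globalSection t k)

theorem IsGluing.unique {F : Sheaf (localeTopology L) (Type u)}
    {s t : ⊤_ (Sheaf (localeTopology L) (Type u)) ⟶ F} {a b : L} (hab : a ⊔ b = ⊤) {c : L}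
    {x y : F.obj.obj (op c)} (hx : IsGluing s t a b x) (hy : IsGluing s t a b y) : x = y := by
  refine sheaf_section_ext F (sieveBelowOr_mem (c := c) hab) fun k f hf => ?_
  rcases hf with hf | hf
  · exact ((hx k f).1 hf).trans ((hy k f).1 hf).symm
  · exact ((hx k f).2 hf).trans ((hy k f).2 hf).symm

theorem exists_isGluing {F : Sheaf (localeTopology L) (Type u)}
    (s t : ⊤_ (Sheaf (localeTopology L) (Type u)) ⟶ F) {a b : L} (hab : IsCompl a b) (c : L) :
    ∃ x : F.obj.obj (op c), IsGluing s t a b x := by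
  classical
  -- The two cases overlap only for `k ≤ a ⊓ b = ⊥`, where a sheaf has at most one section, so
  -- preferring `s` is harmless.
  let z (k : L) : F.obj.obj (op k) := if k ≤ a then globalSection s k else globalSection t k
  have hz₂ {k : L} (hk : k ≤ b) : z k = globalSection t k := by
    by_cases hka : k ≤ a
    · exact sheaf_section_ext_of_le_bot F ((le_inf hka hk).trans hab.inf_eq_bot.le) _ _
    · exact if_neg hka
  have hz {k m : L} (g : m ⟶ k) (hk : k ≤ a ∨ k ≤ b) : F.obj.map g.op (z k) = z m := by
    rcases hk with hk | hk
    · rw [show z k = globalSection s k from if_pos hk,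
        show z m = globalSection s m from if_pos (le_trans g.le hk), map_globalSection]
    · rw [hz₂ hk, hz₂ (le_trans g.le hk), map_globalSection]
  have hF := (isSheaf_iff_isSheaf_of_type _ _).1 F.property _
    (sieveBelowOr_mem (c := c) hab.sup_eq_top)
  obtain ⟨x, hx, -⟩ := hF (fun k _ _ => z k) (by
    intro Y₁ Y₂ Z g₁ g₂ f₁ f₂ h₁ h₂ _
    exact (hz g₁ h₁).trans (hz g₂ h₂).symm)
  exact ⟨x, fun k f => ⟨fun hk => (hx f (Or.inl hk)).trans (if_pos hk),
    fun hk => (hx f (Or.inr hk)).trans (hz₂ hk)⟩⟩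

theorem IsGluing.map {F : Sheaf (localeTopology L) (Type u)}
    {s t : ⊤_ (Sheaf (localeTopology L) (Type u)) ⟶ F} {a b a' b' : L} {c d : L}
    {x : F.obj.obj (op c)} (hx : IsGluing s t a b x) (f : d ⟶ c)
    (ha : ∀ k ≤ d, k ≤ a' → k ≤ a) (hb : ∀ k ≤ d, k ≤ b' → k ≤ b) :
    IsGluing s t a' b' (F.obj.map f.op x) := by
  intro k g
  have e : F.obj.map g.op (F.obj.map f.op x) = F.obj.map (g ≫ f).op x := by
    rw [op_comp, F.obj.map_comp]
    rfl
  rw [e]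
  exact ⟨fun hk => (hx k (g ≫ f)).1 (ha k g.le hk), fun hk => (hx k (g ≫ f)).2 (hb k g.le hk)⟩

/-- Below `d`, the complement of a restriction to `d` agrees with the original complement; this
gives naturality of `omegaDesc`. -/
theorem le_compl_inf_iff {a k d : L} (hk : k ≤ d) : k ≤ (d ⊓ a)ᶜ ↔ k ≤ aᶜ := by
  rw [le_compl_iff_disjoint_right, le_compl_iff_disjoint_right, disjoint_iff, disjoint_iff,
    ← inf_assoc, inf_eq_left.2 hk]

/-- A morphism out of `Ω` takes the values prescribed by its restrictions to `⊤` and `⊥`. -/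
theorem isGluing_app {F : Sheaf (localeTopology L) (Type u)}
    (g : (omega (localeTopology L)).sheaf ⟶ F) {c : L} (S : ClosedSieve (localeTopology L) c) :
    IsGluing ((omega (localeTopology L)).toDistLatSheaf.topMap ≫ g)
      ((omega (localeTopology L)).toDistLatSheaf.botMap ≫ g) (sieveVal S) (sieveVal S)ᶜ
      (g.hom.app (op c) S) := by
  intro k f
  have e : F.obj.map f.op (g.hom.app (op c) S) =
      g.hom.app (op k) (ClosedSieve.pullback f S) :=
    (ConcreteCategory.congr_hom (g.hom.naturality f.op) S).symm
  rw [e]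
  constructor
  · intro hk
    refine congrArg (g.hom.app (op k)) (sieveVal_injective
      (((sieveVal_pullback f S).trans (inf_eq_left.2 hk)).trans (sieveVal_top k).symm))
  · intro hk
    refine congrArg (g.hom.app (op k)) (sieveVal_injective
      (((sieveVal_pullback f S).trans ?_).trans (sieveVal_bot k).symm))
    exact disjoint_iff.1 (le_compl_iff_disjoint_right.1 hk)

/-- `isGluing_app` fixes the value at `S` below `S` and below its complement, and Booleanness makes
these two a cover. -/
theorem omega_hom_ext (h : IsBooleanSite (localeTopology L))
    {F : Sheaf (localeTopology L) (Type u)} {g g' : (omega (localeTopology L)).sheaf ⟶ F}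
    (ht : (omega (localeTopology L)).toDistLatSheaf.topMap ≫ g =
      (omega (localeTopology L)).toDistLatSheaf.topMap ≫ g')
    (hb : (omega (localeTopology L)).toDistLatSheaf.botMap ≫ g =
      (omega (localeTopology L)).toDistLatSheaf.botMap ≫ g') : g = g' := by
  apply Sheaf.hom_ext
  ext c S
  have h₁ := isGluing_app g (c := c.unop) S
  have h₂ := isGluing_app g' (c := c.unop) S
  rw [ht, hb] at h₁
  exact h₁.unique (isBooleanSite_iff.1 h _).sup_eq_top h₂

/-- Over a Boolean locale, two global sections of a sheaf define a morphism out of `Ω`. -/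
noncomputable def omegaDesc (h : IsBooleanSite (localeTopology L))
    {F : Sheaf (localeTopology L) (Type u)}
    (s t : ⊤_ (Sheaf (localeTopology L) (Type u)) ⟶ F) :
    (omega (localeTopology L)).sheaf ⟶ F where
  hom :=
    { app := fun c => ↾fun S : ClosedSieve (localeTopology L) c.unop =>
        (exists_isGluing s t (isBooleanSite_iff.1 h (sieveVal S)) c.unop).choose
      naturality := by
        intro c d f
        ext S
        change ClosedSieve (localeTopology L) c.unop at S
        have hc := (exists_isGluing s t (isBooleanSite_iff.1 h (sieveVal S)) c.unop).choose_spec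
        have hd := (exists_isGluing s t (isBooleanSite_iff.1 h
          (sieveVal (ClosedSieve.pullback f.unop S))) d.unop).choose_spec
        -- Gluings are unique, so the choices made over `c` and over `d` are compatible.
        refine hd.unique (isBooleanSite_iff.1 h _).sup_eq_top (hc.map f.unop ?_ ?_)
        · intro k _ hk
          exact hk.trans ((sieveVal_pullback f.unop S).le.trans inf_le_right)
        · intro k hk hk'
          rw [sieveVal_pullback] at hk'
          exact (le_compl_inf_iff hk).1 hk' }

theorem isGluing_omegaDesc (h : IsBooleanSite (localeTopology L))
    {F : Sheaf (localeTopology L) (Type u)}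
    (s t : ⊤_ (Sheaf (localeTopology L) (Type u)) ⟶ F) {c : L}
    (S : ClosedSieve (localeTopology L) c) :
    IsGluing s t (sieveVal S) (sieveVal S)ᶜ ((omegaDesc h s t).hom.app (op c) S) :=
  (exists_isGluing s t (isBooleanSite_iff.1 h (sieveVal S)) c).choose_spec

theorem topMap_omegaDesc (h : IsBooleanSite (localeTopology L))
    {F : Sheaf (localeTopology L) (Type u)}
    (s t : ⊤_ (Sheaf (localeTopology L) (Type u)) ⟶ F) :
    (omega (localeTopology L)).toDistLatSheaf.topMap ≫ omegaDesc h s t = s := by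
  refine globalSection_injective fun c => ?_
  have := ((isGluing_omegaDesc h s t (⊤ : ClosedSieve (localeTopology L) c)) c (𝟙 c)).1
    (sieveVal_top c).ge
  rw [op_id, F.obj.map_id] at this
  exact this

theorem botMap_omegaDesc (h : IsBooleanSite (localeTopology L))
    {F : Sheaf (localeTopology L) (Type u)}
    (s t : ⊤_ (Sheaf (localeTopology L) (Type u)) ⟶ F) :
    (omega (localeTopology L)).toDistLatSheaf.botMap ≫ omegaDesc h s t = t := by
  refine globalSection_injective fun c => ?_
  have := ((isGluing_omegaDesc h s t (⊥ : ClosedSieve (localeTopology L) c)) c (𝟙 c)).2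
    (by rw [sieveVal_bot, compl_bot]; exact le_top)
  rw [op_id, F.obj.map_id] at this
  exact this

theorem isIso_twoToOmega_of_isBooleanSite (h : IsBooleanSite (localeTopology L)) :
    IsIso (twoToOmega (localeTopology L)) := by
  refine ⟨omegaDesc h coprod.inl coprod.inr, ?_, ?_⟩
  · apply coprod.hom_ext
    · rw [twoToOmega, coprod.inl_desc_assoc, topMap_omegaDesc, Category.comp_id]
    · rw [twoToOmega, coprod.inr_desc_assoc, botMap_omegaDesc, Category.comp_id]
  · apply omega_hom_ext h
    · rw [← Category.assoc, topMap_omegaDesc, twoToOmega, coprod.inl_desc, Category.comp_id]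
    · rw [← Category.assoc, botMap_omegaDesc, twoToOmega, coprod.inr_desc, Category.comp_id]

theorem isBooleanSite_iff_isIso_twoToOmega :
    IsBooleanSite (localeTopology L) ↔ IsIso (twoToOmega (localeTopology L)) :=
  ⟨isIso_twoToOmega_of_isBooleanSite, isBooleanSite_of_isIso_twoToOmega⟩

end Locale

end LocalicTopos

theorem mainTheorem12 {L : Type u} [Order.Frame L]
    (hreg : IsRegularLocale L) (hcomp : IsCompactLocale L) :
    ((idl (omega (localeTopology L)).toDistLatSheaf).IsIsomorphic (omega (localeTopology L)) ↔
        IsIso (twoToOmega (localeTopology L))) ∧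
      (IsIso (toIdl (omega (localeTopology L)).toDistLatSheaf) ↔
        IsIso (twoToOmega (localeTopology L))) ∧
      (IsIso (twoToOmega (localeTopology L)) ↔ IsBooleanSite (localeTopology L)) := by
  rw [← isBooleanSite_iff_isIso_twoToOmega]
  exact ⟨⟨isBooleanSite_of_isIsomorphic hreg hcomp, isIsomorphic_of_isBooleanSite⟩,
    ⟨isBooleanSite_of_isIso_toIdl hreg hcomp, isIso_toIdl_of_isBooleanSite⟩, Iff.rfl⟩
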